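/- All Hilbert spaces are complex and separable, subspaces are closed, operators are linear and bounded, and $\vee$ denotes closed linear span. A unitary operator is \emph{reductive} if each of its invariant subspaces is reducing. A \emph{scalar spectral measure} of a unitary operator $U$ with projection-valued spectral measure $E$ is a finite positive Borel measure $\nu$ on the unit circle such that $\nu(B)=0$ if and only if $E(B)=0$, for all Borel sets $B$. A \emph{unitary asymptote} of an operator $T$ on $\mathcal H$ is a pair $(X,U)$, where $U$ is a unitary operator on a Hilbert space $\mathcal K$ and $X:\mathcal H\to\mathcal K$ is a bounded linear map with $XT=UX$, such that for every pair $(Y,V)$, where $V$ is a unitary operator on a Hilbert space $\mathcal L$ and $Y:\mathcal H\to\mathcal L$ is a bounded linear map with $YT=VY$, there is a unique bounded linear map $Z:\mathcal K\to\mathcal L$ with $ZU=VZ$ and $Y=ZX$. \textbf{Theorem.} For $n\ge 0$ let $U_{0n}$ be a reductive unitary operator on a Hilbert space $\mathcal K_{0n}$, and suppose that the scalar spectral measures of the operators $U_{0n}$, $n\ge 0$, are pairwise singular. Let $T$ be an operator on a Hilbert space $\mathcal H$, and let $\mathcal H_n\ne\{0\}$, $n\ge 0$, be invariant subspaces of $T$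 such that for every $n\geq 0$ $$\mathcal H=\mathcal H_n\dotplus\vee_{k\ne n}\mathcal H_k .$$ Suppose that for every $n\ge0$ there is a bounded linear map $X_n:\mathcal H_n\to\mathcal K_{0n}$ with bounded inverse such that $X_nT|_{\mathcal H_n}=U_{0n}X_n$, and that $\sup_{n\ge0}\|X_n\|\,\|X_n^{-1}\|<\infty$. Let $\mathcal Q_n$ be the skew projection of $\mathcal H$ onto $\mathcal H_n$ parallel to $\vee_{k\neq n}\mathcal H_k$, and suppose that $\sup_{n\ge0}\|\mathcal Q_n\|<\infty$. Then $T$ has a unitary asymptote if and only if there exists $c>0$ such that $$c^2\sum_n\|x_n\|^2\le\Bigl\|\sum_n x_n\Bigr\|^2$$ for every finite family $\{x_n\}_n$ such that $x_n\in\mathcal H_n$ for all $n$. -/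

import Mathlib

universe u

open MeasureTheory

/-- The Borel σ-algebra on the unit circle `𝕋`. -/
noncomputable instance Circle.instMeasurableSpaceBorel : MeasurableSpace Circle := borel Circle

instance Circle.instBorelSpace : BorelSpace Circle := ⟨rfl⟩

section Unitary

variable {K : Type u} [NormedAddCommGroup K] [InnerProductSpace ℂ K]

/-- A unitary operator `U` is reductive if each of its (closed) invariant subspaces `M` is reducing,
i.e. the orthogonal complement of `M` is invariant as well. -/
def IsReductiveUnitary (U : K ≃ₗᵢ[ℂ] K) : Prop :=
  ∀ M : Submodule ℂ K, IsClosed (M : Set K) → (∀ x ∈ M, U x ∈ M) → ∀ x ∈ Mᗮ, U x ∈ Mᗮ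

/-- `μ` is the spectral measure of the unitary operator `U` at the vector `x`: the finite Borel
measure `μ = ⟨E(·)x, x⟩` on the circle, `E` being the projection-valued spectral measure of `U`.
It is determined by its moments `∫ z ^ k dμ = ⟨U ^ k x, x⟩`, `k ∈ ℤ`
(Lean's inner product is linear in the second argument). -/
def IsSpectralMeasureAt (U : K ≃ₗᵢ[ℂ] K) (x : K) (μ : Measure Circle) : Prop :=
  IsFiniteMeasure μ ∧ ∀ k : ℤ, ∫ z : Circle, (z : ℂ) ^ k ∂μ = inner ℂ x ((U ^ k) x)

/-- `ν` is a scalar spectral measure of the unitary operator `U`: a finite Borel measure on the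
circle with the same null sets as the projection-valued spectral measure `E` of `U`. Here
`E(B) = 0` is expressed by `⟨E(B)x, x⟩ = 0` for every vector `x`. -/
def IsScalarSpectralMeasure (U : K ≃ₗᵢ[ℂ] K) (ν : Measure Circle) : Prop :=
  IsFiniteMeasure ν ∧ ∀ B : Set Circle, MeasurableSet B →
    (ν B = 0 ↔ ∀ (x : K) (μ : Measure Circle), IsSpectralMeasureAt U x μ → μ B = 0)

end Unitary

section Asymptote

variable {H : Type u} [NormedAddCommGroup H] [InnerProductSpace ℂ H]

/-- The pair `(X, U)`, with `U` unitary on `K` and `X : H → K` bounded, is a unitary asymptote of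
`T`: `X T = U X`, and every other pair `(Y, V)` with `V` unitary (on a separable Hilbert space) and
`Y T = V Y` factors as `Y = Z X` for a unique bounded `Z` such that `Z U = V Z`. -/
def IsUnitaryAsymptote (T : H →L[ℂ] H) {K : Type u} [NormedAddCommGroup K]
    [InnerProductSpace ℂ K] (X : H →L[ℂ] K) (U : K ≃ₗᵢ[ℂ] K) : Prop :=
  (∀ h : H, X (T h) = U (X h)) ∧
    ∀ (L : Type u) [NormedAddCommGroup L] [InnerProductSpace ℂ L] [CompleteSpace L]
      [TopologicalSpace.SeparableSpace L] (Y : H →L[ℂ] L) (V : L ≃ₗᵢ[ℂ] L),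
      (∀ h : H, Y (T h) = V (Y h)) →
        ∃! Z : K →L[ℂ] L, (∀ k : K, Z (U k) = V (Z k)) ∧ ∀ h : H, Y h = Z (X h)

/-- `T` has a unitary asymptote (on a separable Hilbert space). -/
def HasUnitaryAsymptote (T : H →L[ℂ] H) : Prop :=
  ∃ (K : Type u) (_ : NormedAddCommGroup K) (_ : InnerProductSpace ℂ K) (_ : CompleteSpace K)
    (_ : TopologicalSpace.SeparableSpace K) (X : H →L[ℂ] K) (U : K ≃ₗᵢ[ℂ] K),
    IsUnitaryAsymptote T X U

end Asymptote

section Decomposition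

variable {H : Type u} [NormedAddCommGroup H] [InnerProductSpace ℂ H]

/-- `⋁_{k ≠ n} M k`, the closed linear span of all the subspaces `M k`, `k ≠ n`. -/
def closedSpanOthers (M : ℕ → Submodule ℂ H) (n : ℕ) : Submodule ℂ H :=
  (⨆ (k : ℕ) (_ : k ≠ n), M k).topologicalClosure

/-- The skew projection `Q_n` of `H` onto `M n` parallel to `⋁_{k ≠ n} M k`, as a bounded
operator on `H`. -/
noncomputable def skewProjection [CompleteSpace H] (M : ℕ → Submodule ℂ H)
    (hclosed : ∀ n, IsClosed (M n : Set H))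
    (hdecomp : ∀ n, IsCompl (M n) (closedSpanOthers M n)) (n : ℕ) : H →L[ℂ] H :=
  (M n).projectionL (closedSpanOthers M n)
    (Submodule.IsCompl.isTopCompl_of_isClosed (hdecomp n) (hclosed n)
      (Submodule.isClosed_topologicalClosure _))

end Decomposition

/-! If `A` intertwines unitaries `U` and `V`, then `‖A‖² - A†A` is positive and commutes with `U`,
so the spectral measure of `V` at `A x` is at most `‖A‖²` times that of `U` at `x`. It is therefore
null where either scalar spectral measure is, and singularity gives `A = 0` (`intertwiner_eq_zero`).
Consequently any `Y` intertwining `T` with a unitary maps distinct summands to orthogonal subspaces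
(`inner_eq_zero_of_intertwines`).

Necessity: let `S` be the map of an asymptote. Each rescaled `X n` composed with the skew
projection, placed in the `n`-th coordinate of the Hilbert sum, factors through `S`. The open
mapping theorem bounds the factors uniformly, so `S` is bounded below on every summand by one
constant. Pythagoras for the orthogonal images then gives the estimate.

Sufficiency: the estimate makes the combined map `S` into the Hilbert sum bounded, with dense range.
Orthogonality of the images under any competing `Y` yields `‖Y h‖ ≤ ‖Y‖ C ‖S h‖`, so `Y` factors
uniquely through `S`. -/

/-! ### Spectral measures of unitary operators: existence and uniqueness. -/

section SpectralMeasure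

/-- The inclusion of the circle in `ℂ`, as a continuous function. -/
def circleCoe : C(Circle, ℂ) := ⟨fun z => z, continuous_subtype_val⟩

@[simp]
theorem circleCoe_apply (z : Circle) : circleCoe z = z := rfl

theorem circleCoe_mem_unitary : circleCoe ∈ unitary C(Circle, ℂ) := by
  rw [Unitary.mem_iff]
  constructor <;> ext z <;> simp [← Circle.coe_inv_eq_conj]

theorem coe_unitary_zpow_circleCoe (k : ℤ) (z : Circle) :
    (((⟨circleCoe, circleCoe_mem_unitary⟩ : unitary C(Circle, ℂ)) ^ k : unitary C(Circle, ℂ)) :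
      C(Circle, ℂ)) z = (z : ℂ) ^ k := by
  cases k with
  | ofNat n => simp
  | negSucc n =>
    rw [zpow_negSucc, zpow_negSucc, ← Unitary.star_eq_inv]
    simp [← Circle.coe_inv_eq_conj]

variable {K : Type u} [NormedAddCommGroup K] [InnerProductSpace ℂ K]

/-- The zeroth moment; it turns a vanishing spectral measure into a vanishing vector. -/
theorem IsSpectralMeasureAt.measureReal_univ {U : K ≃ₗᵢ[ℂ] K} {x : K} {μ : Measure Circle}
    (h : IsSpectralMeasureAt U x μ) : μ.real Set.univ = ‖x‖ ^ 2 := by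
  have h0 := h.2 0
  simp only [zpow_zero, integral_const, Complex.real_smul, mul_one, LinearIsometryEquiv.coe_one,
    id_eq] at h0
  rw [inner_self_eq_norm_sq_to_K] at h0
  exact Complex.ofReal_injective (by simpa using h0)

variable [CompleteSpace K]

theorem integrable_circle_zpow (k : ℤ) (μ : Measure Circle) [IsFiniteMeasure μ] :
    Integrable (fun z : Circle => (z : ℂ) ^ k) μ := by
  simp_rw [← coe_unitary_zpow_circleCoe]
  exact (ContinuousMap.continuous _).integrable_of_hasCompactSupport
    (HasCompactSupport.of_compactSpace _)

/-- The continuous functional calculus of a unitary operator on the circle. -/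
theorem exists_starAlgHom_circle (U : K ≃ₗᵢ[ℂ] K) :
    ∃ Φ : C(Circle, ℂ) →⋆ₐ[ℂ] (K →L[ℂ] K), ∀ (k : ℤ) (f : C(Circle, ℂ)),
      (∀ z : Circle, f z = (z : ℂ) ^ k) → ∀ x, Φ f x = (U ^ k) x := by
  set u : unitary (K →L[ℂ] K) := Unitary.linearIsometryEquiv.symm U with hu
  have hn : IsStarNormal (u : K →L[ℂ] K) := inferInstance
  let j : C(spectrum ℂ (u : K →L[ℂ] K), Circle) :=
    ⟨fun z => ⟨z, by
      have := spectrum.subset_circle_of_unitary (𝕜 := ℂ) u.2 z.2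
      simpa [Submonoid.unitSphere] using this⟩, by
      exact Continuous.subtype_mk continuous_subtype_val _⟩
  let Φ : C(Circle, ℂ) →⋆ₐ[ℂ] (K →L[ℂ] K) :=
    (cfcHom (R := ℂ) hn).comp (ContinuousMap.compStarAlgHom' ℂ ℂ j)
  have hΦ : Φ circleCoe = u := by
    have := cfcHom_id (R := ℂ) hn
    simpa only [Φ, StarAlgHom.comp_apply] using! this
  refine ⟨Φ, fun k f hf x => ?_⟩
  have hf' : f = (((⟨circleCoe, circleCoe_mem_unitary⟩ : unitary C(Circle, ℂ)) ^ k :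
      unitary C(Circle, ℂ)) : C(Circle, ℂ)) := by
    ext z
    rw [hf, coe_unitary_zpow_circleCoe]
  -- As a group homomorphism on unitaries, `ψ` respects negative powers too, so only the value at
  -- the coordinate function matters.
  let ψ : unitary C(Circle, ℂ) →* unitary (K →L[ℂ] K) :=
    Unitary.map
      { toFun := Φ
        map_one' := map_one Φ
        map_mul' := map_mul Φ
        map_star' := map_star Φ }
  have h1 : ψ ⟨circleCoe, circleCoe_mem_unitary⟩ = u := Subtype.ext hΦ
  have h2 : Φ f = ((ψ (⟨circleCoe, circleCoe_mem_unitary⟩ ^ k) : unitary _) : K →L[ℂ] K) := by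
    rw [hf']; rfl
  rw [h2, map_zpow, h1]
  have h3 : u ^ k = Unitary.linearIsometryEquiv.symm (U ^ k) := by rw [map_zpow]
  rw [h3]
  rfl

/-- Existence of the spectral measure of a unitary operator at a vector. -/
theorem exists_isSpectralMeasureAt (U : K ≃ₗᵢ[ℂ] K) (x : K) :
    ∃ μ : Measure Circle, IsSpectralMeasureAt U x μ := by
  obtain ⟨Φ, hΦ⟩ := exists_starAlgHom_circle U
  let c : C(Circle, ℝ) → C(Circle, ℂ) := fun f => ⟨fun z => (f z : ℂ), by fun_prop⟩
  let Λ₀ : CompactlySupportedContinuousMap Circle ℝ →ₗ[ℝ] ℝ :=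
    { toFun := fun f => (inner ℂ x (Φ (c f) x)).re
      map_add' := fun f g => by
        have : c ((f + g : CompactlySupportedContinuousMap Circle ℝ) : C(Circle, ℝ))
            = c f + c g := by ext z; simp [c]
        rw [this, map_add]; simp
      map_smul' := fun r f => by
        have : c ((r • f : CompactlySupportedContinuousMap Circle ℝ) : C(Circle, ℝ))
            = (r : ℂ) • c f := by ext z; simp [c]
        rw [this, map_smul]; simp }
  have hself : ∀ f : C(Circle, ℝ), star (c f) = c f := fun f => by ext z; simp [c]
  have hsym : ∀ (f : C(Circle, ℝ)) (y z : K), inner ℂ (Φ (c f) y) z = inner ℂ y (Φ (c f) z) := by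
    intro f y z
    rw [← ContinuousLinearMap.adjoint_inner_right, ← ContinuousLinearMap.star_eq_adjoint,
      ← map_star, hself]
  have hpos : ∀ f : CompactlySupportedContinuousMap Circle ℝ, 0 ≤ f → 0 ≤ Λ₀ f := by
    intro f hf
    -- With `f = g²` and `Φ (c g)` symmetric, the functional becomes `‖Φ (c g) x‖²`.
    let g : C(Circle, ℝ) := ⟨fun z => √(f z), by fun_prop⟩
    have hfg : c f = c g * c g := by
      ext z
      simp only [c, g, ContinuousMap.mul_apply, ContinuousMap.coe_mk, ← Complex.ofReal_mul]
      rw [Real.mul_self_sqrt (hf z)]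
    change 0 ≤ (inner ℂ x (Φ (c f) x)).re
    rw [hfg, map_mul, mul_apply_eq_comp, ← hsym]
    exact inner_self_nonneg (𝕜 := ℂ)
  have him : ∀ f : C(Circle, ℝ), (inner ℂ x (Φ (c f) x)).im = 0 := by
    intro f
    rw [← Complex.conj_eq_iff_im, inner_conj_symm, hsym]
  let Λ := PositiveLinearMap.mk₀ Λ₀ hpos
  have key : ∀ f : C(Circle, ℝ),
      ((∫ z, f z ∂(RealRMK.rieszMeasure Λ) : ℝ) : ℂ) = inner ℂ x (Φ (c f) x) := by
    intro f
    have h1 : ∫ z, f z ∂(RealRMK.rieszMeasure Λ) = (inner ℂ x (Φ (c f) x)).re :=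
      RealRMK.integral_rieszMeasure Λ (CompactlySupportedContinuousMap.continuousMapEquiv f)
    rw [h1]
    apply Complex.ext
    · simp
    · simp [him]
  refine ⟨RealRMK.rieszMeasure Λ, inferInstance, fun k => ?_⟩
  let e : C(Circle, ℂ) := ((⟨circleCoe, circleCoe_mem_unitary⟩ : unitary C(Circle, ℂ)) ^ k :
      unitary C(Circle, ℂ))
  have he : ∀ z : Circle, e z = (z : ℂ) ^ k := coe_unitary_zpow_circleCoe k
  let f₁ : C(Circle, ℝ) := ⟨fun z => (e z).re, by fun_prop⟩
  let f₂ : C(Circle, ℝ) := ⟨fun z => (e z).im, by fun_prop⟩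
  have hdec : e = c f₁ + Complex.I • c f₂ := by
    ext z
    simp [c, f₁, f₂, mul_comm Complex.I]
  rw [← hΦ k e he, hdec, map_add, map_smul, add_apply, inner_add_right,
    smul_apply, inner_smul_right, ← key, ← key]
  have hint : Integrable (fun z => e z) (RealRMK.rieszMeasure Λ) :=
    e.continuous.integrable_of_hasCompactSupport (HasCompactSupport.of_compactSpace _)
  simp_rw [← he]
  have := integral_re_add_im hint
  rw [← this, mul_comm Complex.I]
  rfl

/-- A finite measure on the circle is determined by its moments. -/
theorem Circle.measure_ext_of_moments {μ ν : Measure Circle} [IsFiniteMeasure μ]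
    [IsFiniteMeasure ν] (h : ∀ k : ℤ, ∫ z : Circle, (z : ℂ) ^ k ∂μ = ∫ z : Circle, (z : ℂ) ^ k ∂ν) :
    μ = ν := by
  let ζ : BoundedContinuousFunction Circle ℂ := BoundedContinuousFunction.mkOfCompact circleCoe
  refine ext_of_forall_mem_subalgebra_integral_eq_of_polish (𝕜 := ℂ)
    (A := StarAlgebra.adjoin ℂ {ζ}) ?_ ?_
  · intro x y hxy
    refine ⟨fun z => (z : ℂ), ⟨circleCoe, ⟨ζ, StarAlgebra.subset_adjoin ℂ _ rfl, rfl⟩, rfl⟩, ?_⟩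
    exact fun h => hxy (Circle.ext h)
  · intro g hg
    have hint : ∀ (g : BoundedContinuousFunction Circle ℂ) (ρ : Measure Circle)
        [IsFiniteMeasure ρ], Integrable (fun z => g z) ρ := fun g ρ _ => g.integrable ρ
    -- The star algebra generated by `z` is spanned by products of `z` and its conjugate, that is,
    -- by integer powers of `z`.
    have hg' : g ∈ Submodule.span ℂ
        (Submonoid.closure ({ζ} ∪ star {ζ}) : Set (BoundedContinuousFunction Circle ℂ)) := by
      rw [← Algebra.adjoin_eq_span]
      exact hg
    clear hg
    induction hg' using Submodule.span_induction with
    | mem x hx =>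
      have : ∃ k : ℤ, ∀ z : Circle, x z = (z : ℂ) ^ k := by
        induction hx using Submonoid.closure_induction with
        | mem x hx =>
          rcases hx with hx | hx
          · exact ⟨1, fun z => by rw [hx]; simp [ζ]⟩
          · refine ⟨-1, fun z => ?_⟩
            have hx' : x = star ζ := by rw [← star_star x]; exact congrArg star hx
            rw [hx']; simp [ζ, ← Circle.coe_inv_eq_conj]
        | one => exact ⟨0, fun z => by simp⟩
        | mul x y _ _ hx hy =>
          obtain ⟨k, hk⟩ := hx
          obtain ⟨l, hl⟩ := hy
          exact ⟨k + l, fun z => by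
            rw [zpow_add₀ (Circle.coe_ne_zero z), ← hk, ← hl]; rfl⟩
      obtain ⟨k, hk⟩ := this
      simp_rw [hk]
      exact h k
    | zero => simp
    | add x y hx hy ihx ihy =>
      simp only [BoundedContinuousFunction.add_apply]
      rw [integral_add (hint _ _) (hint _ _), integral_add (hint _ _) (hint _ _)]
      rw [ihx, ihy]
    | smul a x hx ihx =>
      simp only [BoundedContinuousFunction.smul_apply]
      rw [integral_smul, integral_smul, ihx]

end SpectralMeasure

/-! ### Intertwiners of unitary operators. -/

section Intertwining

variable {K L : Type u} [NormedAddCommGroup K] [InnerProductSpace ℂ K]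
  [NormedAddCommGroup L] [InnerProductSpace ℂ L]

theorem intertwine_zpow {U : K ≃ₗᵢ[ℂ] K} {V : L ≃ₗᵢ[ℂ] L} {A : K →L[ℂ] L}
    (h : ∀ x, A (U x) = V (A x)) (k : ℤ) (x : K) : A ((U ^ k) x) = (V ^ k) (A x) := by
  have hsymm : ∀ x, A (U⁻¹ x) = V⁻¹ (A x) := fun x => by
    change _ = V.symm (A x)
    rw [LinearIsometryEquiv.eq_symm_apply, ← h]
    exact congrArg A (U.apply_symm_apply x)
  induction k generalizing x with
  | zero => rfl
  | succ n ih => rw [zpow_add_one, zpow_add_one]; exact (ih _).trans (congrArg _ (h x))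
  | pred n ih => rw [zpow_sub_one, zpow_sub_one]; exact (ih _).trans (congrArg _ (hsymm x))

variable [CompleteSpace K] [CompleteSpace L]

/-- Unitarity makes the adjoints of `U` and `V` their inverses; hence `A†A` commutes with `U`. -/
theorem intertwine_adjoint {U : K ≃ₗᵢ[ℂ] K} {V : L ≃ₗᵢ[ℂ] L} {A : K →L[ℂ] L}
    (h : ∀ x, A (U x) = V (A x)) (y : L) :
    ContinuousLinearMap.adjoint A (V y) = U (ContinuousLinearMap.adjoint A y) := by
  refine ext_inner_right ℂ fun x => ?_
  have hx : A (U.symm x) = V.symm (A x) := by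
    rw [LinearIsometryEquiv.eq_symm_apply, ← h, U.apply_symm_apply]
  rw [ContinuousLinearMap.adjoint_inner_left, LinearIsometryEquiv.inner_map_eq_flip,
    LinearIsometryEquiv.inner_map_eq_flip, ContinuousLinearMap.adjoint_inner_left, hx]

/-- There is a positive operator `D` commuting with `U` such that `A†A + D² = ‖A‖²`. -/
theorem exists_defect {U : K ≃ₗᵢ[ℂ] K} {V : L ≃ₗᵢ[ℂ] L} {A : K →L[ℂ] L}
    (h : ∀ x, A (U x) = V (A x)) :
    ∃ D : K →L[ℂ] K, (∀ x, D (U x) = U (D x)) ∧ ∀ x y,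
      inner ℂ (A x) (A y) + inner ℂ (D x) (D y) = (‖A‖ ^ 2 : ℂ) * inner ℂ x y := by
  set P : K →L[ℂ] K := (‖A‖ ^ 2 : ℂ) • 1 - ContinuousLinearMap.adjoint A ∘L A with hP
  have hPi : ∀ x y, inner ℂ x (P y) = (‖A‖ ^ 2 : ℂ) * inner ℂ x y - inner ℂ (A x) (A y) := by
    intro x y
    simp [hP, ContinuousLinearMap.adjoint_inner_right]
  have hP0 : 0 ≤ P := by
    rw [ContinuousLinearMap.nonneg_iff_isPositive, ContinuousLinearMap.isPositive_iff_complex]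
    intro x
    have h1 : inner ℂ (P x) x = ((‖A‖ ^ 2 * ‖x‖ ^ 2 - ‖A x‖ ^ 2 : ℝ) : ℂ) := by
      rw [← inner_conj_symm, hPi, inner_self_eq_norm_sq_to_K, inner_self_eq_norm_sq_to_K]
      simp
    rw [h1]
    refine ⟨congrArg _ (Complex.ofReal_re _), ?_⟩
    have := A.le_opNorm x
    have h2 : ‖A x‖ ^ 2 ≤ (‖A‖ * ‖x‖) ^ 2 := by gcongr
    simp only [RCLike.re_to_complex, Complex.ofReal_re]
    nlinarith
  have hcomm : Commute P (U : K →L[ℂ] K) := by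
    ext x
    simp [hP, h, intertwine_adjoint h]
  have hsq : CFC.sqrt P * CFC.sqrt P = P := CFC.sqrt_mul_sqrt_self P hP0
  have hsa : IsSelfAdjoint (CFC.sqrt P) := (CFC.sqrt_nonneg P).isSelfAdjoint
  refine ⟨CFC.sqrt P, fun x => ?_, fun x y => ?_⟩
  · have hc : Commute (CFC.sqrt P) (U : K →L[ℂ] K) := by
      rw [CFC.sqrt_eq_cfc]
      exact hcomm.cfc_nnreal _
    exact congrArg (fun B : K →L[ℂ] K => B x) hc
  · have : inner ℂ (CFC.sqrt P x) (CFC.sqrt P y) = inner ℂ x (P y) := by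
      conv_rhs => rw [← hsq]
      rw [mul_apply_eq_comp]
      nth_rewrite 3 [← hsa.star_eq]
      rw [ContinuousLinearMap.star_eq_adjoint, ContinuousLinearMap.adjoint_inner_right]
    rw [this, hPi]; ring

/-- Unitary operators with mutually singular scalar spectral measures have no nonzero
intertwiner. -/
theorem intertwiner_eq_zero {U : K ≃ₗᵢ[ℂ] K} {V : L ≃ₗᵢ[ℂ] L} {ν ρ : Measure Circle}
    (hν : IsScalarSpectralMeasure U ν) (hρ : IsScalarSpectralMeasure V ρ)
    (hsing : ν.MutuallySingular ρ) {A : K →L[ℂ] L} (h : ∀ x, A (U x) = V (A x)) (x : K) :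
    A x = 0 := by
  obtain ⟨D, hD, hAD⟩ := exists_defect h
  obtain ⟨μ, hμ⟩ := exists_isSpectralMeasureAt U x
  obtain ⟨α, hα⟩ := exists_isSpectralMeasureAt V (A x)
  obtain ⟨δ, hδ⟩ := exists_isSpectralMeasureAt U (D x)
  have := hμ.1
  have := hα.1
  have := hδ.1
  -- The defect identity, applied to `x` and `(U ^ k) x`, matches all moments; it gives the
  -- domination `α ≤ ‖A‖² μ`.
  have hadd : α + δ = (‖A‖₊ ^ 2) • μ := by
    refine Circle.measure_ext_of_moments fun k => ?_
    have hint : ∀ (τ : Measure Circle) [IsFiniteMeasure τ],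
        Integrable (fun z : Circle => (z : ℂ) ^ k) τ := fun τ _ =>
      integrable_circle_zpow k τ
    rw [integral_add_measure (hint _) (hint _), integral_smul_nnreal_measure, hα.2, hδ.2, hμ.2,
      ← intertwine_zpow h, ← intertwine_zpow hD, hAD]
    simp [NNReal.smul_def]
  obtain ⟨s, hs, hs0, hs1⟩ := hsing
  have hμs : μ s = 0 := (hν.2 s hs).1 hs0 x μ hμ
  have hαs : α sᶜ = 0 := (hρ.2 _ hs.compl).1 hs1 _ α hα
  have hαs' : α s = 0 := by
    have h1 : (α + δ) s = 0 := by rw [hadd]; simp [hμs]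
    rw [Measure.add_apply] at h1
    exact (add_eq_zero.1 h1).1
  have hα0 : α Set.univ = 0 := by
    rw [← measure_add_measure_compl hs, hαs, hαs', add_zero]
  have h2 := hα.measureReal_univ
  rw [Measure.real, hα0] at h2
  simpa using h2.symm

end Intertwining

/-! ### Hilbert sums of spaces and of unitary operators. -/

section HilbertSum

variable {K : ℕ → Type u} [∀ n, NormedAddCommGroup (K n)] [∀ n, InnerProductSpace ℂ (K n)]

theorem memℓp_linearIsometryEquiv (U : ∀ n, K n ≃ₗᵢ[ℂ] K n) (f : lp K 2) :
    Memℓp (fun n => U n (f n)) 2 := by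
  have h := lp.memℓp f
  rw [memℓp_gen_iff (by simp)] at h ⊢
  simpa using h

/-- The orthogonal sum of a sequence of unitary operators. -/
noncomputable def unitarySum (U : ∀ n, K n ≃ₗᵢ[ℂ] K n) : lp K 2 ≃ₗᵢ[ℂ] lp K 2 where
  toFun f := ⟨fun n => U n (f n), memℓp_linearIsometryEquiv U f⟩
  invFun f := ⟨fun n => (U n).symm (f n), memℓp_linearIsometryEquiv (fun n => (U n).symm) f⟩
  left_inv f := by ext n; simp
  right_inv f := by ext n; simp
  map_add' f g := by ext n; exact map_add (U n) _ _
  map_smul' a f := by ext n; simp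
  norm_map' f := by
    rw [lp.norm_eq_tsum_rpow (by simp), lp.norm_eq_tsum_rpow (by simp)]
    simp

@[simp]
theorem unitarySum_apply (U : ∀ n, K n ≃ₗᵢ[ℂ] K n) (f : lp K 2) (n : ℕ) :
    unitarySum U f n = U n (f n) := rfl

theorem lp_submodule_dense {P : Submodule ℂ (lp K 2)}
    (hP : ∀ n (k : K n), lp.single 2 n k ∈ P) : Dense (P : Set (lp K 2)) := by
  intro f
  refine mem_closure_of_tendsto (lp.hasSum_single (by simp) f) (Filter.Eventually.of_forall ?_)
  exact fun s => P.sum_mem fun n _ => hP n _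

theorem lp_separableSpace [∀ n, TopologicalSpace.SeparableSpace (K n)] :
    TopologicalSpace.SeparableSpace (lp K 2) := by
  set S : Set (lp K 2) := ⋃ n, Set.range (lp.single 2 n : K n → lp K 2)
  have hsep : TopologicalSpace.IsSeparable S :=
    TopologicalSpace.IsSeparable.iUnion fun n =>
      TopologicalSpace.isSeparable_range (lp.isometry_single n).continuous
  have hd : Dense (Submodule.span ℂ S : Set (lp K 2)) :=
    lp_submodule_dense fun n k => Submodule.subset_span (Set.mem_iUnion.2 ⟨n, k, rfl⟩)
  have h2 := (hsep.span (R := ℂ)).closure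
  rw [hd.closure_eq] at h2
  exact TopologicalSpace.isSeparable_univ_iff.1 h2

variable {H : Type u} [NormedAddCommGroup H] [InnerProductSpace ℂ H]

theorem lp_sum_sq_le {K : ℕ → Type*} [∀ n, NormedAddCommGroup (K n)] (f : lp K 2)
    (s : Finset ℕ) : ∑ n ∈ s, ‖f n‖ ^ 2 ≤ ‖f‖ ^ 2 := by
  simpa using lp.sum_rpow_le_norm_rpow (p := 2) (by simp) f s

/-- A square summable family of operators defines an operator into the Hilbert sum. -/
theorem exists_lp_map (R : ∀ n, H →L[ℂ] K n) {C : ℝ} (hC : 0 ≤ C)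
    (hR : ∀ (s : Finset ℕ) (h : H), ∑ n ∈ s, ‖R n h‖ ^ 2 ≤ (C * ‖h‖) ^ 2) :
    ∃ S : H →L[ℂ] lp K 2, ∀ h n, S h n = R n h := by
  let S : H →ₗ[ℂ] lp K 2 :=
    { toFun := fun h => ⟨fun n => R n h,
        memℓp_gen' (C := (C * ‖h‖) ^ 2) fun s => by simpa using hR s h⟩
      map_add' := fun x y => by ext n; exact map_add (R n) _ _
      map_smul' := fun a x => by ext n; simp }
  refine ⟨S.mkContinuous C fun h => ?_, fun h n => rfl⟩
  refine lp.norm_le_of_forall_sum_le (by simp) (by positivity) fun s => ?_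
  simpa [S] using hR s h

end HilbertSum

/-! ### Uniform bounds for factorisations, and Pythagoras. -/

section OpenMapping

variable {H K L : Type u} [NormedAddCommGroup H] [InnerProductSpace ℂ H]
  [NormedAddCommGroup K] [InnerProductSpace ℂ K]
  [NormedAddCommGroup L] [InnerProductSpace ℂ L]

/-- The space of operators intertwining `A` and `B`. -/
def intertwiners (A : H →L[ℂ] H) (B : L →L[ℂ] L) : Submodule ℂ (H →L[ℂ] L) where
  carrier := {Y | ∀ h, Y (A h) = B (Y h)}
  add_mem' {Y Z} hY hZ h := by simp [hY h, hZ h]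
  zero_mem' h := by simp
  smul_mem' a Y hY h := by simp [hY h]

theorem isClosed_intertwiners (A : H →L[ℂ] H) (B : L →L[ℂ] L) :
    IsClosed (intertwiners A B : Set (H →L[ℂ] L)) := by
  change IsClosed {Y : H →L[ℂ] L | ∀ h, Y (A h) = B (Y h)}
  simp only [Set.ofPred_forall]
  exact isClosed_iInter fun h => isClosed_eq (by fun_prop) (by fun_prop)

/-- The factorisation through a unitary asymptote is bounded. -/
theorem IsUnitaryAsymptote.exists_bound [CompleteSpace L] [TopologicalSpace.SeparableSpace L]
    {T : H →L[ℂ] H} {X : H →L[ℂ] K} {U : K ≃ₗᵢ[ℂ] K} (hXU : IsUnitaryAsymptote T X U)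
    (V : L ≃ₗᵢ[ℂ] L) :
    ∃ C > 0, ∀ Y : H →L[ℂ] L, (∀ h, Y (T h) = V (Y h)) →
      ∃ Z : K →L[ℂ] L, (∀ h, Z (X h) = Y h) ∧ ‖Z‖ ≤ C * ‖Y‖ := by
  have hc1 : CompleteSpace (intertwiners (U : K →L[ℂ] K) (V : L →L[ℂ] L)) :=
    (isClosed_intertwiners _ _).completeSpace_coe
  have hc2 : CompleteSpace (intertwiners T (V : L →L[ℂ] L)) :=
    (isClosed_intertwiners _ _).completeSpace_coe
  let F : intertwiners (U : K →L[ℂ] K) (V : L →L[ℂ] L) →L[ℂ] intertwiners T (V : L →L[ℂ] L) :=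
    (((ContinuousLinearMap.compL ℂ H K L).flip X).comp (Submodule.subtypeL _)).codRestrict _
      fun Z h => by
        have := Z.2 (X h)
        simpa [hXU.1 h] using this
  -- Surjectivity of `Z ↦ Z X` is the existence half of the universal property.
  have hF : Function.Surjective F := by
    intro Y
    obtain ⟨Z, ⟨hZ, hZY⟩, -⟩ := hXU.2 L Y.1 V Y.2
    exact ⟨⟨Z, hZ⟩, Subtype.ext (ContinuousLinearMap.ext fun h => (hZY h).symm)⟩
  obtain ⟨C, hC, hb⟩ := ContinuousLinearMap.exists_preimage_norm_le
    (σ' := RingHom.id ℂ) (E := intertwiners (U : K →L[ℂ] K) (V : L →L[ℂ] L)) (F := intertwiners T (V : L →L[ℂ] L)) F hF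
  refine ⟨C, hC, fun Y hY => ?_⟩
  obtain ⟨Z, hZ, hZn⟩ := hb ⟨Y, hY⟩
  exact ⟨Z.1, fun h => congrArg (fun W => W.1 h) hZ, hZn⟩

theorem norm_sq_sum_of_pairwise_inner_eq_zero {ι : Type*} (s : Finset ι) (y : ι → L)
    (h : ∀ i j, i ≠ j → inner ℂ (y i) (y j) = 0) :
    ‖∑ i ∈ s, y i‖ ^ 2 = ∑ i ∈ s, ‖y i‖ ^ 2 := by
  classical
  induction s using Finset.induction_on with
  | empty => simp
  | insert a s ha ih =>
    rw [Finset.sum_insert ha, Finset.sum_insert ha, ← ih, sq, sq, sq]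
    refine norm_add_sq_eq_norm_sq_add_norm_sq_of_inner_eq_zero (𝕜 := ℂ) _ _ ?_
    rw [inner_sum]
    exact Finset.sum_eq_zero fun i hi => h _ _ fun hai => ha (hai ▸ hi)

end OpenMapping

/-! ### Skew projections and density of finite sums. -/

section Decomposition

variable {H : Type u} [NormedAddCommGroup H] [InnerProductSpace ℂ H] {M : ℕ → Submodule ℂ H}

theorem iSup_dense_of_isCompl (hdecomp : ∀ n, IsCompl (M n) (closedSpanOthers M n)) :
    Dense ((⨆ n, M n : Submodule ℂ H) : Set H) := by
  rw [Submodule.dense_iff_topologicalClosure_eq_top, eq_top_iff, ← (hdecomp 0).sup_eq_top]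
  refine sup_le ((le_iSup M 0).trans (Submodule.le_topologicalClosure _)) ?_
  exact Submodule.topologicalClosure_mono (iSup_le fun k => iSup_le fun _ => le_iSup M k)

theorem induction_finite_sums (hdecomp : ∀ n, IsCompl (M n) (closedSpanOthers M n))
    {p : H → Prop} (hp : IsClosed {h | p h})
    (hsum : ∀ x : ℕ →₀ H, (∀ n, x n ∈ M n) → p (∑ n ∈ x.support, x n)) (h : H) : p h := by
  refine (iSup_dense_of_isCompl hdecomp).induction (P := p) (fun x hx => ?_) hp h
  obtain ⟨f, hf, rfl⟩ := (Submodule.mem_iSup_iff_exists_finsupp M x).1 hx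
  exact hsum f hf

variable [CompleteSpace H]

/-- The skew projection onto `M n`, with codomain `M n`. -/
noncomputable def skewProjectionOnto (M : ℕ → Submodule ℂ H)
    (hclosed : ∀ n, IsClosed (M n : Set H))
    (hdecomp : ∀ n, IsCompl (M n) (closedSpanOthers M n)) (n : ℕ) : H →L[ℂ] M n :=
  (M n).projectionOntoL (closedSpanOthers M n)
    (Submodule.IsCompl.isTopCompl_of_isClosed (hdecomp n) (hclosed n)
      (Submodule.isClosed_topologicalClosure _))

variable (hclosed : ∀ n, IsClosed (M n : Set H))
  (hdecomp : ∀ n, IsCompl (M n) (closedSpanOthers M n))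

theorem norm_skewProjectionOnto_le (n : ℕ) :
    ‖skewProjectionOnto M hclosed hdecomp n‖ ≤ ‖skewProjection M hclosed hdecomp n‖ :=
  ContinuousLinearMap.opNorm_le_bound _ (norm_nonneg _) fun h =>
    (skewProjection M hclosed hdecomp n).le_opNorm h

theorem skewProjectionOnto_of_mem {n : ℕ} {x : H} (hx : x ∈ M n) :
    skewProjectionOnto M hclosed hdecomp n x = ⟨x, hx⟩ :=
  Submodule.projectionOntoL_apply_left _ (⟨x, hx⟩ : M n)

theorem skewProjectionOnto_of_mem_of_ne {m n : ℕ} (hmn : m ≠ n) {x : H} (hx : x ∈ M m) :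
    skewProjectionOnto M hclosed hdecomp n x = 0 :=
  (Submodule.projectionOntoL_apply_eq_zero_iff _).2 <|
    Submodule.le_topologicalClosure _ <| Submodule.mem_iSup_of_mem m <|
      Submodule.mem_iSup_of_mem hmn hx

theorem skewProjectionOnto_sum {x : ℕ →₀ H} (hx : ∀ n, x n ∈ M n) (n : ℕ) :
    skewProjectionOnto M hclosed hdecomp n (∑ m ∈ x.support, x m) = ⟨x n, hx n⟩ := by
  rw [map_sum, Finset.sum_eq_single n, skewProjectionOnto_of_mem hclosed hdecomp (hx n)]
  · exact fun m _ hmn => skewProjectionOnto_of_mem_of_ne hclosed hdecomp hmn (hx m)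
  · intro hn
    rw [Finsupp.notMem_support_iff.1 hn, map_zero]

/-- All summands are invariant, so the identity is clear on finite sums and extends by density. -/
theorem skewProjectionOnto_map {T : H →L[ℂ] H} (hinv : ∀ n, ∀ x ∈ M n, T x ∈ M n) (n : ℕ)
    (h : H) : (skewProjectionOnto M hclosed hdecomp n (T h) : H) =
      T (skewProjectionOnto M hclosed hdecomp n h) := by
  refine induction_finite_sums hdecomp
    (p := fun h => (skewProjectionOnto M hclosed hdecomp n (T h) : H) =
      T (skewProjectionOnto M hclosed hdecomp n h))
    (isClosed_eq (by fun_prop) (by fun_prop)) (fun x hx => ?_) h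
  rw [skewProjectionOnto_sum hclosed hdecomp hx, map_sum, map_sum, Finset.sum_eq_single n,
    skewProjectionOnto_of_mem hclosed hdecomp (hinv n _ (hx n))]
  · exact fun m _ hmn =>
      skewProjectionOnto_of_mem_of_ne hclosed hdecomp hmn (hinv m _ (hx m))
  · intro hn
    rw [Finsupp.notMem_support_iff.1 hn, map_zero, map_zero]

end Decomposition

/-- Rescaling an isomorphism to a contraction keeps control of the inverse. -/
theorem exists_rescale {E F : Type*} [NormedAddCommGroup E] [NormedSpace ℂ E]
    [NormedAddCommGroup F] [NormedSpace ℂ F] [Nontrivial E] (X : E ≃L[ℂ] F) {C : ℝ}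
    (hC : ‖(X : E →L[ℂ] F)‖ * ‖(X.symm : F →L[ℂ] E)‖ ≤ C) :
    ∃ a : ℂ, a ≠ 0 ∧ (∀ x, ‖a • X x‖ ≤ ‖x‖) ∧ ∀ x, ‖x‖ ≤ C * ‖a • X x‖ := by
  have hpos : 0 < ‖(X : E →L[ℂ] F)‖ := X.norm_pos
  refine ⟨(‖(X : E →L[ℂ] F)‖⁻¹ : ℝ), by simpa using hpos.ne', fun x => ?_, fun x => ?_⟩
  · rw [norm_smul, Complex.norm_real, norm_inv, norm_norm, inv_mul_le_iff₀ hpos]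
    exact (X : E →L[ℂ] F).le_opNorm x
  · rw [norm_smul, Complex.norm_real, norm_inv, norm_norm]
    calc ‖x‖ = ‖(X.symm : F →L[ℂ] E) (X x)‖ := by simp
      _ ≤ ‖(X.symm : F →L[ℂ] E)‖ * ‖X x‖ := ContinuousLinearMap.le_opNorm _ _
      _ = ‖(X : E →L[ℂ] F)‖ * ‖(X.symm : F →L[ℂ] E)‖ * (‖(X : E →L[ℂ] F)‖⁻¹ * ‖X x‖) := by
        field_simp
      _ ≤ C * (‖(X : E →L[ℂ] F)‖⁻¹ * ‖X x‖) := by gcongr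

/-! ### The two implications. -/

section Main

variable {H : Type u} [NormedAddCommGroup H] [InnerProductSpace ℂ H]
  {K : ℕ → Type u} [∀ n, NormedAddCommGroup (K n)] [∀ n, InnerProductSpace ℂ (K n)]
  [∀ n, CompleteSpace (K n)]
  {L : Type u} [NormedAddCommGroup L] [InnerProductSpace ℂ L] [CompleteSpace L]

/-- An operator intertwining `T` with a unitary operator maps distinct summands to orthogonal
subspaces. -/
theorem inner_eq_zero_of_intertwines {U : ∀ n, K n ≃ₗᵢ[ℂ] K n} {ν : ℕ → Measure Circle}
    (hν : ∀ n, IsScalarSpectralMeasure (U n) (ν n))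
    (hsing : ∀ m n, m ≠ n → (ν m).MutuallySingular (ν n))
    {T : H →L[ℂ] H} {M : ℕ → Submodule ℂ H} (hinv : ∀ n, ∀ x ∈ M n, T x ∈ M n)
    {X : ∀ n, M n ≃L[ℂ] K n} (hX : ∀ n, ∀ x : M n, X n ⟨T x, hinv n x x.2⟩ = U n (X n x))
    {V : L ≃ₗᵢ[ℂ] L} {Y : H →L[ℂ] L} (hY : ∀ h, Y (T h) = V (Y h))
    {m n : ℕ} (hmn : m ≠ n) {x y : H} (hx : x ∈ M m) (hy : y ∈ M n) :
    inner ℂ (Y x) (Y y) = 0 := by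
  -- Transporting `Y` to the unitary models makes `(Z m)† Z n` an intertwiner of `U n` and `U m`,
  -- hence zero.
  let Z : ∀ n, K n →L[ℂ] L := fun n => Y ∘L (M n).subtypeL ∘L ((X n).symm : K n →L[ℂ] M n)
  have hZX : ∀ n (x : M n), Z n (X n x) = Y x := fun n x => by simp [Z]
  have hZ : ∀ n k, Z n (U n k) = V (Z n k) := fun n k => by
    obtain ⟨x, rfl⟩ := (X n).surjective k
    rw [← hX, hZX, hZX, hY]
  have h0 := intertwiner_eq_zero (hν n) (hν m) (hsing n m hmn.symm)
    (A := ContinuousLinearMap.adjoint (Z m) ∘L Z n)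
    (fun k => by simp [hZ, intertwine_adjoint (hZ m)]) (X n ⟨y, hy⟩)
  rw [← hZX m ⟨x, hx⟩, ← hZX n ⟨y, hy⟩, ← ContinuousLinearMap.adjoint_inner_right]
  rw [ContinuousLinearMap.comp_apply] at h0
  rw [h0, inner_zero_right]

variable [CompleteSpace H]

/-- The lower estimate implied by the existence of a unitary asymptote. -/
theorem exists_lower_bound_of_hasUnitaryAsymptote
    [∀ n, TopologicalSpace.SeparableSpace (K n)] {U : ∀ n, K n ≃ₗᵢ[ℂ] K n}
    {T : H →L[ℂ] H} {M : ℕ → Submodule ℂ H}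
    (hclosed : ∀ n, IsClosed (M n : Set H)) (hinv : ∀ n, ∀ x ∈ M n, T x ∈ M n)
    (hdecomp : ∀ n, IsCompl (M n) (closedSpanOthers M n))
    {X : ∀ n, M n ≃L[ℂ] K n} (hX : ∀ n, ∀ x : M n, X n ⟨T x, hinv n x x.2⟩ = U n (X n x))
    {a : ℕ → ℂ} {C q : ℝ} (hC : 0 ≤ C) (ha₁ : ∀ n x, ‖a n • X n x‖ ≤ ‖x‖)
    (ha₂ : ∀ n x, ‖x‖ ≤ C * ‖a n • X n x‖)
    (hq : ∀ n, ‖skewProjectionOnto M hclosed hdecomp n‖ ≤ q)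
    {S : H →L[ℂ] L} {B : L ≃ₗᵢ[ℂ] L} (hS : IsUnitaryAsymptote T S B)
    (horth : ∀ m n, m ≠ n → ∀ x ∈ M m, ∀ y ∈ M n, inner ℂ (S x) (S y) = 0) :
    ∃ c : ℝ, 0 < c ∧ ∀ (s : Finset ℕ) (x : ℕ → H), (∀ n ∈ s, x n ∈ M n) →
        c ^ 2 * ∑ n ∈ s, ‖x n‖ ^ 2 ≤ ‖∑ n ∈ s, x n‖ ^ 2 := by
  have hsep : TopologicalSpace.SeparableSpace (lp K 2) := lp_separableSpace
  obtain ⟨D, hD, hb⟩ := hS.exists_bound (unitarySum U)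
  have hlow : ∀ n, ∀ x ∈ M n, ‖x‖ ≤ (C * (D * q)) * ‖S x‖ := by
    intro n x hx
    let R : H →L[ℂ] K n := a n • ((X n : M n →L[ℂ] K n) ∘L skewProjectionOnto M hclosed hdecomp n)
    have hR : ∀ h, R h = a n • X n (skewProjectionOnto M hclosed hdecomp n h) := fun h => rfl
    -- All these test maps share one target and one unitary, so the same open-mapping constant `D`
    -- serves every `n`.
    let Y : H →L[ℂ] lp K 2 := lp.singleContinuousLinearMap ℂ K 2 n ∘L R
    have hYn : ∀ h, ‖Y h‖ = ‖R h‖ := fun h => lp.norm_single (by simp) n (R h)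
    have hY : ∀ h, Y (T h) = unitarySum U (Y h) := by
      intro h
      have h1 : R (T h) = U n (R h) := by
        rw [hR, hR, map_smul, ← hX]
        congr 2
        exact Subtype.ext (skewProjectionOnto_map hclosed hdecomp hinv n h)
      ext m
      change lp.single 2 n (R (T h)) m = U m (lp.single 2 n (R h) m)
      rw [h1]
      rcases eq_or_ne m n with rfl | hmn
      · simp
      · rw [lp.single_apply_ne 2 n _ hmn, lp.single_apply_ne 2 n _ hmn, map_zero]
    have hYq : ‖Y‖ ≤ q := by
      refine ContinuousLinearMap.opNorm_le_bound _ ((ContinuousLinearMap.opNorm_nonneg _).trans (hq n)) fun h => ?_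
      rw [hYn, hR]
      exact (ha₁ n _).trans (ContinuousLinearMap.le_of_opNorm_le _ (hq n) h)
    obtain ⟨Z, hZ, hZn⟩ := hb Y hY
    calc ‖x‖ ≤ C * ‖a n • X n ⟨x, hx⟩‖ := ha₂ n ⟨x, hx⟩
      _ = C * ‖Z (S x)‖ := by
        rw [hZ, hYn, hR, skewProjectionOnto_of_mem hclosed hdecomp hx]
      _ ≤ C * ((D * q) * ‖S x‖) := by
        gcongr
        exact ContinuousLinearMap.le_of_opNorm_le _ (hZn.trans (by gcongr)) _
      _ = (C * (D * q)) * ‖S x‖ := by ring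
  have hq0 : 0 ≤ q := (ContinuousLinearMap.opNorm_nonneg _).trans (hq 0)
  set E : ℝ := C * (D * q)
  have hE0 : 0 ≤ E := by positivity
  -- The `+ 1` keeps the constant positive even if `E * ‖S‖ = 0`.
  refine ⟨(E * ‖S‖ + 1)⁻¹, by positivity, fun s x hx => ?_⟩
  have hsum : ∑ n ∈ s, ‖x n‖ ^ 2 ≤ (E * ‖S‖ * ‖∑ n ∈ s, x n‖) ^ 2 := by
    have hxs : ∑ n ∈ s, ‖S (x n)‖ ^ 2 = ‖S (∑ n ∈ s, x n)‖ ^ 2 := by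
      -- Membership in the summands is known only on `s`, so the family is extended by zero.
      have h1 := norm_sq_sum_of_pairwise_inner_eq_zero s (fun n => S (if n ∈ s then x n else 0))
        (fun m n hmn => by
          refine horth m n hmn _ ?_ _ ?_ <;> split_ifs with h
          exacts [hx _ h, zero_mem _, hx _ h, zero_mem _])
      rw [map_sum]
      convert h1.symm using 1
      · exact Finset.sum_congr rfl fun n hn => by rw [if_pos hn]
      · congr 2
        exact Finset.sum_congr rfl fun n hn => by rw [if_pos hn]
    calc ∑ n ∈ s, ‖x n‖ ^ 2 ≤ ∑ n ∈ s, (E * ‖S (x n)‖) ^ 2 :=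
          Finset.sum_le_sum fun n hn => by gcongr; exact hlow n _ (hx n hn)
      _ = E ^ 2 * ‖S (∑ n ∈ s, x n)‖ ^ 2 := by
        rw [← hxs, Finset.mul_sum]
        exact Finset.sum_congr rfl fun n _ => by ring
      _ = (E * ‖S (∑ n ∈ s, x n)‖) ^ 2 := by ring
      _ ≤ (E * ‖S‖ * ‖∑ n ∈ s, x n‖) ^ 2 := by
        rw [mul_assoc E ‖S‖]
        exact pow_le_pow_left₀ (by positivity)
          (mul_le_mul_of_nonneg_left (S.le_opNorm _) hE0) 2
  rw [inv_pow, inv_mul_le_iff₀ (by positivity), ← mul_pow]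
  refine hsum.trans ?_
  gcongr
  linarith

/-- The lower estimate implies that the orthogonal sum of the unitary operators is a unitary
asymptote. -/
theorem hasUnitaryAsymptote_of_lower_bound [TopologicalSpace.SeparableSpace H]
    {U : ∀ n, K n ≃ₗᵢ[ℂ] K n}
    {T : H →L[ℂ] H} {M : ℕ → Submodule ℂ H}
    (hclosed : ∀ n, IsClosed (M n : Set H)) (hinv : ∀ n, ∀ x ∈ M n, T x ∈ M n)
    (hdecomp : ∀ n, IsCompl (M n) (closedSpanOthers M n))
    {X : ∀ n, M n ≃L[ℂ] K n} (hX : ∀ n, ∀ x : M n, X n ⟨T x, hinv n x x.2⟩ = U n (X n x))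
    {a : ℕ → ℂ} {C c : ℝ} (hC : 0 ≤ C) (ha₀ : ∀ n, a n ≠ 0)
    (ha₁ : ∀ n x, ‖a n • X n x‖ ≤ ‖x‖) (ha₂ : ∀ n x, ‖x‖ ≤ C * ‖a n • X n x‖)
    (hc : 0 < c) (hlow : ∀ (s : Finset ℕ) (x : ℕ → H), (∀ n ∈ s, x n ∈ M n) →
        c ^ 2 * ∑ n ∈ s, ‖x n‖ ^ 2 ≤ ‖∑ n ∈ s, x n‖ ^ 2)
    (horth : ∀ (L : Type u) [NormedAddCommGroup L] [InnerProductSpace ℂ L] [CompleteSpace L]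
      (Y : H →L[ℂ] L) (V : L ≃ₗᵢ[ℂ] L), (∀ h, Y (T h) = V (Y h)) →
      ∀ m n, m ≠ n → ∀ x ∈ M m, ∀ y ∈ M n, inner ℂ (Y x) (Y y) = 0) :
    HasUnitaryAsymptote T := by
  let R : ∀ n, H →L[ℂ] K n := fun n =>
    a n • ((X n : M n →L[ℂ] K n) ∘L skewProjectionOnto M hclosed hdecomp n)
  have hR : ∀ n h, R n h = a n • X n (skewProjectionOnto M hclosed hdecomp n h) :=
    fun n h => rfl
  have hRsum : ∀ (x : ℕ →₀ H) (hx : ∀ n, x n ∈ M n) (n : ℕ),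
      R n (∑ m ∈ x.support, x m) = a n • X n ⟨x n, hx n⟩ := fun x hx n => by
    rw [hR, skewProjectionOnto_sum hclosed hdecomp hx]
  have hbound : ∀ (s : Finset ℕ) (h : H), ∑ n ∈ s, ‖R n h‖ ^ 2 ≤ (c⁻¹ * ‖h‖) ^ 2 := by
    intro s h
    refine induction_finite_sums hdecomp
      (p := fun h => ∑ n ∈ s, ‖R n h‖ ^ 2 ≤ (c⁻¹ * ‖h‖) ^ 2)
      (isClosed_le (by fun_prop) (by fun_prop)) (fun x hx => ?_) h
    have h1 := hlow x.support x fun n _ => hx n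
    rw [mul_pow, inv_pow, le_inv_mul_iff₀ (by positivity)]
    refine le_trans ?_ h1
    gcongr c ^ 2 * ?_
    calc ∑ n ∈ s, ‖R n (∑ m ∈ x.support, x m)‖ ^ 2 ≤ ∑ n ∈ s, ‖x n‖ ^ 2 :=
          Finset.sum_le_sum fun n _ => by
            rw [hRsum x hx]
            gcongr
            exact ha₁ n _
      _ ≤ ∑ n ∈ x.support, ‖x n‖ ^ 2 := by
        rw [← Finset.sum_filter_of_ne (s := s) (p := (· ∈ x.support)) fun n _ hn => by
          rw [Finsupp.mem_support_iff]
          rintro h0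
          simp [h0] at hn]
        exact Finset.sum_le_sum_of_subset_of_nonneg (fun n hn => (Finset.mem_filter.1 hn).2)
          fun _ _ _ => by positivity
  obtain ⟨S, hS⟩ := exists_lp_map R (inv_nonneg.2 hc.le) hbound
  have hST : ∀ h, S (T h) = unitarySum U (S h) := by
    intro h
    ext n
    rw [unitarySum_apply, hS, hS, hR, hR, map_smul, ← hX]
    congr 2
    exact Subtype.ext (skewProjectionOnto_map hclosed hdecomp hinv n h)
  -- Density gives separability of the target, the extension of `Y`, and its uniqueness.
  have hdense : DenseRange S := by
    refine lp_submodule_dense (P := S.range) fun n k => ?_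
    obtain ⟨x, hx⟩ := (X n).surjective ((a n)⁻¹ • k)
    refine ⟨x, ?_⟩
    ext m
    change S _ m = _
    rw [hS, hR]
    rcases eq_or_ne m n with rfl | hmn
    · rw [skewProjectionOnto_of_mem hclosed hdecomp x.2]
      simp [hx, ha₀]
    · rw [skewProjectionOnto_of_mem_of_ne hclosed hdecomp hmn.symm x.2,
        lp.single_apply_ne 2 n _ hmn]
      simp
  have hsep : TopologicalSpace.SeparableSpace (lp K 2) := hdense.separableSpace S.continuous
  refine ⟨lp K 2, inferInstance, inferInstance, inferInstance, hsep, S, unitarySum U, hST, ?_⟩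
  intro L _ _ _ _ Y V hY
  have hYS : ∀ h, ‖Y h‖ ≤ (‖Y‖ * C) * ‖S h‖ := by
    intro h
    refine induction_finite_sums hdecomp (p := fun h => ‖Y h‖ ≤ (‖Y‖ * C) * ‖S h‖)
      (isClosed_le (by fun_prop) (by fun_prop)) (fun x hx => ?_) h
    refine le_of_sq_le_sq ?_ (by positivity)
    calc ‖Y (∑ n ∈ x.support, x n)‖ ^ 2 = ∑ n ∈ x.support, ‖Y (x n)‖ ^ 2 := by
          rw [map_sum]
          exact norm_sq_sum_of_pairwise_inner_eq_zero _ (fun n => Y (x n)) fun m n hmn =>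
            horth L Y V hY m n hmn _ (hx m) _ (hx n)
      _ ≤ ∑ n ∈ x.support, (‖Y‖ * (C * ‖S (∑ m ∈ x.support, x m) n‖)) ^ 2 :=
        Finset.sum_le_sum fun n _ => by
          rw [hS, hRsum x hx]
          gcongr
          exact Y.le_of_opNorm_le_of_le le_rfl (ha₂ n ⟨x n, hx n⟩)
      _ = (‖Y‖ * C) ^ 2 * ∑ n ∈ x.support, ‖S (∑ m ∈ x.support, x m) n‖ ^ 2 := by
        rw [Finset.mul_sum]
        exact Finset.sum_congr rfl fun n _ => by ring
      _ ≤ (‖Y‖ * C) ^ 2 * ‖S (∑ m ∈ x.support, x m)‖ ^ 2 := by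
        gcongr
        exact lp_sum_sq_le _ _
      _ = _ := by ring
  let Z : lp K 2 →L[ℂ] L := (Y : H →ₗ[ℂ] L).extendOfNorm (S : H →ₗ[ℂ] lp K 2)
  have hZ : ∀ h, Z (S h) = Y h := fun h =>
    LinearMap.extendOfNorm_eq (f := (Y : H →ₗ[ℂ] L)) (e := (S : H →ₗ[ℂ] lp K 2)) hdense
      ⟨_, hYS⟩ h
  refine ⟨Z, ⟨fun k => ?_, fun h => (hZ h).symm⟩, fun Z' hZ' => ?_⟩
  · refine hdense.induction_on (p := fun k => Z (unitarySum U k) = V (Z k)) k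
      (isClosed_eq (by fun_prop) (by fun_prop)) fun h => ?_
    rw [← hST, hZ, hZ, hY]
  · ext k
    refine hdense.induction_on (p := fun k => Z' k = Z k) k
      (isClosed_eq (by fun_prop) (by fun_prop)) fun h => ?_
    rw [hZ, ← hZ'.2]

end Main

theorem mainTheorem4
    {H : Type u} [NormedAddCommGroup H] [InnerProductSpace ℂ H] [CompleteSpace H]
    [TopologicalSpace.SeparableSpace H]
    {K : ℕ → Type u} [∀ n, NormedAddCommGroup (K n)] [∀ n, InnerProductSpace ℂ (K n)]
    [∀ n, CompleteSpace (K n)] [∀ n, TopologicalSpace.SeparableSpace (K n)]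
    -- reductive unitary operators with pairwise singular scalar spectral measures
    (U : ∀ n, K n ≃ₗᵢ[ℂ] K n)
    (hred : ∀ n, IsReductiveUnitary (U n))
    (ν : ℕ → Measure Circle)
    (hν : ∀ n, IsScalarSpectralMeasure (U n) (ν n))
    (hsing : ∀ m n, m ≠ n → (ν m).MutuallySingular (ν n))
    -- the operator, and its nonzero closed invariant subspaces
    (T : H →L[ℂ] H)
    (M : ℕ → Submodule ℂ H)
    (hclosed : ∀ n, IsClosed (M n : Set H))
    (hne : ∀ n, M n ≠ ⊥)
    (hinv : ∀ n, ∀ x ∈ M n, T x ∈ M n)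
    (hdecomp : ∀ n, IsCompl (M n) (closedSpanOthers M n))
    -- the similarities of the restrictions of `T` with the unitary operators
    (X : ∀ n, M n ≃L[ℂ] K n)
    (hX : ∀ n, ∀ x : M n, X n ⟨T x, hinv n x x.2⟩ = U n (X n x))
    (hXbdd : BddAbove (Set.range fun n =>
      ‖(X n : M n →L[ℂ] K n)‖ * ‖((X n).symm : K n →L[ℂ] M n)‖))
    (hQbdd : BddAbove (Set.range fun n => ‖skewProjection M hclosed hdecomp n‖)) :
    HasUnitaryAsymptote T ↔
      ∃ c : ℝ, 0 < c ∧ ∀ (s : Finset ℕ) (x : ℕ → H), (∀ n ∈ s, x n ∈ M n) →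
        c ^ 2 * ∑ n ∈ s, ‖x n‖ ^ 2 ≤ ‖∑ n ∈ s, x n‖ ^ 2 := by
  obtain ⟨C, hC⟩ := hXbdd
  obtain ⟨q, hq⟩ := hQbdd
  have hXC : ∀ n, ‖(X n : M n →L[ℂ] K n)‖ * ‖((X n).symm : K n →L[ℂ] M n)‖ ≤ C :=
    fun n => hC ⟨n, rfl⟩
  have hC0 : 0 ≤ C := le_trans (by positivity) (hXC 0)
  have hresc : ∀ n, ∃ a : ℂ, a ≠ 0 ∧ (∀ x, ‖a • X n x‖ ≤ ‖x‖) ∧ ∀ x, ‖x‖ ≤ C * ‖a • X n x‖ := by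
    intro n
    -- Nonzero summands ensure `‖X n‖ > 0`, so that dividing by it is legitimate.
    have : Nontrivial (M n) := Submodule.nontrivial_iff_ne_bot.2 (hne n)
    exact exists_rescale (X n) (hXC n)
  choose a ha₀ ha₁ ha₂ using hresc
  constructor
  · rintro ⟨L, _, _, _, _, S, B, hS⟩
    exact exists_lower_bound_of_hasUnitaryAsymptote hclosed hinv hdecomp hX hC0 ha₁ ha₂
      (fun n => (norm_skewProjectionOnto_le hclosed hdecomp n).trans (hq ⟨n, rfl⟩)) hS
      fun m n hmn x hx y hy => inner_eq_zero_of_intertwines hν hsing hinv hX hS.1 hmn hx hy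
  · rintro ⟨c, hc, hlow⟩
    exact hasUnitaryAsymptote_of_lower_bound hclosed hinv hdecomp hX hC0 ha₀ ha₁ ha₂ hc hlow
      fun L _ _ _ Y V hY m n hmn x hx y hy =>
        inner_eq_zero_of_intertwines hν hsing hinv hX hY hmn hx hy
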